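/- A learning algorithm without quantum memory that uses $T$ copies of an unknown $n$-qubit state $\rho$ is a rooted tree in which every root-to-leaf path has length $T$: at each non-leaf node $u$ a fresh copy of $\rho$ is measured by itself with a (finite-outcome) POVM $\{F^u_s\}_s$ that may depend on $u$, i.e. on all previous outcomes, and outcome $s$, which has probability $\operatorname{Tr}(F^u_s\rho)$, leads to the corresponding child of $u$; the output of the algorithm is a function of the leaf that is reached. **Theorem.** For every success probability $p>1/2$ there is a constant $c=c(p)>0$ such that the following holds for all $n$, all $M\ge 1$ and all traceless observables (Hermitian matrices) $O_1,\dots,O_M$ on $n$ qubits with operator norm $\|O_i\|\le 1$. Let $$\delta=\delta(O_1,\dots,O_M)=\frac1M\max_{|\phi\rangle}\sum_{i=1}^M\langle\phi|O_i|\phi\rangle^2 ,$$ the maximum being over all unit vectors. 1. (Distinguishing.) Let $0<\epsilon\le 1$. Suppose that, with probability $1/2$ each, the unknown state is either $\rho_0=I/2^n$ or $\rho_i=(I+\epsilon O_i)/2^n$ for a uniformly random $i\in\{1,\dots,M\}$. Every learning algorithm without quantum memory that decides with success probability at least $p$ which of the two cases holds uses $$T\ \ge\ \frac{c}{\epsilon^2\,\delta}$$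 copies of $\rho$ (in particular, no such algorithm exists if $\delta=0$). 2. (Predicting.) Let $\kappa>0$ be such that $\operatorname{Tr}(O_i^2)\ge\kappa 2^n$ for all $i$. Let $0<\epsilon<\kappa$, and consider a learning algorithm without quantum memory that, for every $n$-qubit state $\rho$, outputs with probability at least $p$ estimates of $\operatorname{Tr}(O_1\rho),\dots,\operatorname{Tr}(O_M\rho)$ that are all within error at most $\epsilon$. Then $\delta>0$ and it uses $$T\ \ge\ \frac{c\,\kappa^2}{\epsilon^2\,\delta}$$ copies of $\rho$. The same holds for $\epsilon=\kappa$ if all errors are required to be strictly less than $\epsilon$. In particular, if $O_i^2=I$ for all $i$ (for instance for Pauli observables), one may take $\kappa=1$: predicting all $\operatorname{Tr}(O_i\rho)$ to within $\pm\epsilon$ requires $T\ge\Omega(1/(\epsilon^2\delta))$ for the full range of $\epsilon$. The observables need not be closed under negation. -/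

import Mathlib

open scoped Matrix ComplexOrder

noncomputable section

namespace ShadowLower

/-- Operators on `n` qubits: complex matrices indexed by the `2 ^ n` computational basis strings. -/
abbrev QMatrix (n : ℕ) : Type := Matrix (Fin n → Fin 2) (Fin n → Fin 2) ℂ

/-- A (mixed) state of `n` qubits: a density matrix. -/
def IsState {n : ℕ} (ρ : QMatrix n) : Prop := ρ.PosSemidef ∧ ρ.trace = 1

/-- A POVM on `n` qubits with the `k` outcomes `0, …, k - 1`. Rank-one POVMs
`{ω_s 2 ^ n |ψ_s⟩⟨ψ_s|}` are a special case. -/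
structure POVM (n k : ℕ) where
  /-- The POVM element of each outcome. -/
  effect : Fin k → QMatrix n
  posSemidef : ∀ s, (effect s).PosSemidef
  sum_effect : ∑ s, effect s = 1

/-- The probability `Tr (F_s ρ)` of the outcome `s` when `ρ` is measured. -/
def POVM.prob {n k : ℕ} (F : POVM n k) (ρ : QMatrix n) (s : Fin k) : ℝ :=
  (F.effect s * ρ).trace.re

/-- A learning algorithm without quantum memory that uses `T` copies of the unknown `n`-qubit state:
a rooted tree all of whose root-to-leaf paths have length `T`. At every non-leaf node one fresh copy
is measured, by itself, with a POVM that depends on the node, that is, on all earlier outcomes; the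
children of the node are indexed by the outcomes. -/
inductive LearningTree (n : ℕ) : ℕ → Type
  | leaf : LearningTree n 0
  | node {T k : ℕ} (F : POVM n k) (child : Fin k → LearningTree n T) : LearningTree n (T + 1)

namespace LearningTree

/-- The leaves of a learning tree: the possible final states of the classical memory. -/
def Leaf {n : ℕ} : {T : ℕ} → LearningTree n T → Type
  | _, leaf => Unit
  | _, node (k := k) _ child => (s : Fin k) × (child s).Leaf

/-- A learning tree has finitely many leaves. -/
@[reducible]
def fintypeLeaf {n : ℕ} : {T : ℕ} → (A : LearningTree n T) → Fintype A.Leaf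
  | _, leaf => inferInstanceAs (Fintype Unit)
  | _, node (k := k) _ child =>
    letI : ∀ s, Fintype (child s).Leaf := fun s => (child s).fintypeLeaf
    inferInstanceAs (Fintype ((s : Fin k) × (child s).Leaf))

instance {n T : ℕ} (A : LearningTree n T) : Fintype A.Leaf := A.fintypeLeaf

/-- The probability that the algorithm, run on copies of `ρ`, ends in the given leaf: the product of
the outcome probabilities along the path from the root. -/
def leafProb {n : ℕ} (ρ : QMatrix n) : {T : ℕ} → (A : LearningTree n T) → A.Leaf → ℝ
  | _, leaf, _ => 1
  | _, node F child, l => F.prob ρ l.1 * (child l.1).leafProb ρ l.2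

open Classical in
/-- The probability that the algorithm, run on copies of `ρ`, ends in a leaf that belongs to `E`. -/
def prob {n T : ℕ} (A : LearningTree n T) (ρ : QMatrix n) (E : Set A.Leaf) : ℝ :=
  ∑ l : A.Leaf, if l ∈ E then A.leafProb ρ l else 0

end LearningTree

/-- An observable of `n` qubits that is traceless and has operator norm at most `1`. -/
def IsTracelessObservable {n : ℕ} (O : QMatrix n) : Prop :=
  O.IsHermitian ∧ O.trace = 0 ∧ ‖Matrix.toEuclideanCLM (𝕜 := ℂ) O‖ ≤ 1

/-- The expectation value `⟨φ|O|φ⟩` of the observable `O`. -/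
def pureExpect {n : ℕ} (O : QMatrix n) (φ : (Fin n → Fin 2) → ℂ) : ℝ :=
  (star φ ⬝ᵥ (O *ᵥ φ)).re

/-- The expectation value `Tr (O ρ)` of the observable `O`. -/
def expect {n : ℕ} (O ρ : QMatrix n) : ℝ := (O * ρ).trace.re

/-- `δ(O_1, …, O_M) = (1 / M) max_φ ∑_i ⟨φ|O_i|φ⟩ ^ 2`, over all unit vectors `φ`. The maximum is
taken of a continuous function over the unit sphere, so the supremum is attained. -/
def delta {n M : ℕ} (O : Fin M → QMatrix n) : ℝ :=
  (1 / (M : ℝ)) * sSup {x : ℝ | ∃ φ : (Fin n → Fin 2) → ℂ,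
    star φ ⬝ᵥ φ = 1 ∧ x = ∑ i, pureExpect (O i) φ ^ 2}

/-- The maximally mixed state `I / 2 ^ n`. -/
def mixedState (n : ℕ) : QMatrix n := ((2 : ℂ) ^ n)⁻¹ • (1 : QMatrix n)

/-- The state `(I + ε O) / 2 ^ n`. -/
def spikeState {n : ℕ} (ε : ℝ) (O : QMatrix n) : QMatrix n :=
  ((2 : ℂ) ^ n)⁻¹ • (1 + (ε : ℂ) • O)

/-- The success probability in the many-versus-one distinguishing task: with probability `1 / 2` the
unknown state is `I / 2 ^ n`, and with probability `1 / 2` it is `(I + ε O_i) / 2 ^ n` for a uniformly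
random `i`. The algorithm announces the second case exactly when it ends in a leaf in `guess`. -/
def distinguishProb {n M T : ℕ} (O : Fin M → QMatrix n) (ε : ℝ) (A : LearningTree n T)
    (guess : Set A.Leaf) : ℝ :=
  (1 / 2) * A.prob (mixedState n) guessᶜ
    + (1 / 2) * ((1 / (M : ℝ)) * ∑ i, A.prob (spikeState ε (O i)) guess)

end ShadowLower

end

open ShadowLower

namespace ShadowLower

section

variable {n : ℕ}

/-! ### Expectation values -/

/-! Relative to the maximally mixed state, `spikeState η O` multiplies the probability of a leaf by
`L = ∏ (1 + η x_t)`, where the scores `x_t = Tr (F O) / Tr F` along the path are martingale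
differences because `O` is traceless. With `S = ∑ x_t` and `V = ∑ x_t ^ 2`, orthogonality gives `E S
^ 2 = E V` (`mean_score_sq`), and pathwise `1 - L ≤ |η S| + 4 η ^ 2 V` (`one_sub_likelihood_le`). So
event probabilities under the two states are close whenever `η ^ 2 E V` is small
(`prob_mixedState_le`).

The quantity `δ` controls `V` on average over the observables: at every leaf, `∑ i, V_i ≤ T M δ`
(`sum_quadVar_le`). Averaging over `i` gives the distinguishing bound.

For prediction, the states with `η` and `-η` are each compared with the mixed state. Accurate
estimates under the two signs form disjoint events, whose mixed-state probabilities add up to at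
most `1`. Both signs use the same `V`, so the family need not be closed under negation. -/

lemma dotProduct_star_self_eq (φ : (Fin n → Fin 2) → ℂ) :
    star φ ⬝ᵥ φ = ((∑ j, ‖φ j‖ ^ 2 : ℝ) : ℂ) := by
  simp [dotProduct, ← Complex.conj_mul']

lemma pureExpect_smul (O : QMatrix n) (c : ℝ) (φ : (Fin n → Fin 2) → ℂ) :
    pureExpect O ((c : ℂ) • φ) = c ^ 2 * pureExpect O φ := by
  simp only [pureExpect, star_smul, Matrix.mulVec_smul, smul_dotProduct, dotProduct_smul,
    smul_eq_mul, Complex.star_def, Complex.conj_ofReal, Complex.re_ofReal_mul]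
  ring

lemma abs_pureExpect_le {O : QMatrix n} (hO : ‖Matrix.toEuclideanCLM (𝕜 := ℂ) O‖ ≤ 1)
    (φ : (Fin n → Fin 2) → ℂ) : |pureExpect O φ| ≤ ∑ j, ‖φ j‖ ^ 2 := by
  set v : EuclideanSpace ℂ (Fin n → Fin 2) := WithLp.toLp 2 φ
  have h1 : pureExpect O φ = (inner ℂ v (Matrix.toEuclideanCLM (𝕜 := ℂ) O v)).re := by
    simp [pureExpect, v, EuclideanSpace.inner_eq_star_dotProduct, dotProduct_comm]
  have h2 : ‖v‖ ^ 2 = ∑ j, ‖φ j‖ ^ 2 := by simp [v, EuclideanSpace.norm_sq_eq]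
  rw [h1, ← h2]
  calc |(inner ℂ v (Matrix.toEuclideanCLM (𝕜 := ℂ) O v)).re|
      ≤ ‖inner ℂ v (Matrix.toEuclideanCLM (𝕜 := ℂ) O v)‖ := Complex.abs_re_le_norm _
    _ ≤ ‖v‖ * ‖Matrix.toEuclideanCLM (𝕜 := ℂ) O v‖ := norm_inner_le_norm _ _
    _ ≤ ‖v‖ * (1 * ‖v‖) := by
        gcongr
        exact ContinuousLinearMap.le_of_opNorm_le _ hO _
    _ = ‖v‖ ^ 2 := by ring

lemma trace_mul_eq_sum_pureExpect (B O : QMatrix n) :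
    (Bᴴ * B * O).trace.re = ∑ k, pureExpect O (star (B k)) := by
  rw [Matrix.mul_assoc, Matrix.trace_mul_comm, Matrix.trace, Complex.re_sum]
  refine Finset.sum_congr rfl fun k _ => ?_
  simp [pureExpect, Matrix.mul_apply, Matrix.mul_assoc, dotProduct, Matrix.mulVec]

lemma trace_eq_sum_norm_sq (B : QMatrix n) :
    (Bᴴ * B).trace.re = ∑ k, ∑ j, ‖star (B k) j‖ ^ 2 := by
  rw [Matrix.trace_mul_comm, Matrix.trace, Complex.re_sum]
  refine Finset.sum_congr rfl fun k _ => ?_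
  simp [Matrix.mul_apply, Complex.mul_conj', ← Complex.ofReal_pow]

open scoped MatrixOrder Matrix.Norms.L2Operator in
lemma exists_eq_conjTranspose_mul_self {F : QMatrix n} (hF : F.PosSemidef) :
    ∃ B : QMatrix n, F = Bᴴ * B :=
  CStarAlgebra.nonneg_iff_eq_star_mul_self.1 hF.nonneg

lemma abs_trace_mul_le {F O : QMatrix n} (hF : F.PosSemidef)
    (hO : ‖Matrix.toEuclideanCLM (𝕜 := ℂ) O‖ ≤ 1) :
    |(F * O).trace.re| ≤ F.trace.re := by
  obtain ⟨B, rfl⟩ := exists_eq_conjTranspose_mul_self hF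
  rw [trace_mul_eq_sum_pureExpect, trace_eq_sum_norm_sq]
  exact (Finset.abs_sum_le_sum_abs _ _).trans
    (Finset.sum_le_sum fun k _ => abs_pureExpect_le hO _)

/-! ### Bounds on squared expectation values in terms of `δ` -/

section delta

variable {M : ℕ} {O : Fin M → QMatrix n}

lemma sum_pureExpect_sq_le_of_unit (hM : 0 < M) (hO : ∀ i, IsTracelessObservable (O i))
    {φ : (Fin n → Fin 2) → ℂ} (hφ : star φ ⬝ᵥ φ = 1) :
    ∑ i, pureExpect (O i) φ ^ 2 ≤ M * delta O := by
  have hM' : (M : ℝ) ≠ 0 := by positivity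
  have : (M : ℝ) * delta O = sSup {x : ℝ | ∃ φ : (Fin n → Fin 2) → ℂ,
      star φ ⬝ᵥ φ = 1 ∧ x = ∑ i, pureExpect (O i) φ ^ 2} := by
    rw [delta]; field_simp
  rw [this]
  refine le_csSup ⟨M, ?_⟩ ⟨φ, hφ, rfl⟩
  rintro _ ⟨ψ, hψ, rfl⟩
  have hψ' : ∑ j, ‖ψ j‖ ^ 2 = 1 := by
    rw [dotProduct_star_self_eq] at hψ
    exact_mod_cast hψ
  calc ∑ i, pureExpect (O i) ψ ^ 2 ≤ ∑ _i : Fin M, (1 : ℝ) := by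
        refine Finset.sum_le_sum fun i _ => ?_
        rw [sq_le_one_iff_abs_le_one]
        exact hψ' ▸ abs_pureExpect_le (hO i).2.2 ψ
    _ = M := by simp

lemma delta_nonneg (O : Fin M → QMatrix n) : 0 ≤ delta O := by
  refine mul_nonneg (by positivity) (Real.sSup_nonneg ?_)
  rintro _ ⟨φ, -, rfl⟩
  positivity

lemma sum_pureExpect_sq_le (hM : 0 < M) (hO : ∀ i, IsTracelessObservable (O i))
    (φ : (Fin n → Fin 2) → ℂ) :
    ∑ i, pureExpect (O i) φ ^ 2 ≤ M * delta O * (∑ j, ‖φ j‖ ^ 2) ^ 2 := by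
  set r : ℝ := ∑ j, ‖φ j‖ ^ 2 with hr
  have hr0 : 0 ≤ r := by positivity
  rcases hr0.eq_or_lt with h0 | hpos
  · have hz (i) : pureExpect (O i) φ = 0 := by
      have := abs_pureExpect_le (hO i).2.2 φ
      rw [← hr, ← h0] at this
      exact abs_eq_zero.1 (le_antisymm this (abs_nonneg _))
    simp [hz, ← h0]
  · have hs : (√r) ^ 2 = r := Real.sq_sqrt hr0
    have hs0 : √r ≠ 0 := (Real.sqrt_pos.2 hpos).ne'
    have hunit : star (((√r)⁻¹ : ℝ) • φ) ⬝ᵥ (((√r)⁻¹ : ℝ) • φ) = 1 := by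
      rw [dotProduct_star_self_eq]
      simp only [Pi.smul_apply, norm_smul, mul_pow, ← Finset.mul_sum, ← hr]
      rw [Real.norm_eq_abs, sq_abs, inv_pow, hs, inv_mul_cancel₀ hpos.ne', Complex.ofReal_one]
    have h := sum_pureExpect_sq_le_of_unit hM hO hunit
    have hsm : (((√r)⁻¹ : ℝ) • φ) = (((√r)⁻¹ : ℝ) : ℂ) • φ := by
      ext j; simp
    simp only [hsm, pureExpect_smul, inv_pow, hs, mul_pow, ← Finset.mul_sum] at h
    rwa [inv_mul_le_iff₀ (by positivity), mul_comm] at h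

/-- Extends the pure-state bound to effects of any rank: split `F` into rank-one terms and apply
Cauchy-Schwarz with the squared norms of the vectors as weights. -/
lemma sum_trace_mul_sq_le (hM : 0 < M) (hO : ∀ i, IsTracelessObservable (O i))
    {F : QMatrix n} (hF : F.PosSemidef) :
    ∑ i, (F * O i).trace.re ^ 2 ≤ M * delta O * F.trace.re ^ 2 := by
  obtain ⟨B, rfl⟩ := exists_eq_conjTranspose_mul_self hF
  simp only [trace_mul_eq_sum_pureExpect, trace_eq_sum_norm_sq]
  set w : (Fin n → Fin 2) → ℝ := fun k => ∑ j, ‖star (B k) j‖ ^ 2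
  have hw (k) : 0 ≤ w k := by positivity
  have hδ := delta_nonneg O
  have key (i) : (∑ k, pureExpect (O i) (star (B k))) ^ 2 ≤
      (∑ k, w k) * ∑ k, pureExpect (O i) (star (B k)) ^ 2 / w k := by
    refine Finset.sum_sq_le_sum_mul_sum_of_sq_le_mul _ (fun k _ => hw k)
      (fun k _ => div_nonneg (sq_nonneg _) (hw k)) fun k _ => ?_
    -- A zero weight contributes `0 / 0 = 0`, harmless since the expectation vanishes too.
    rcases eq_or_ne (w k) 0 with h | h
    · have := abs_pureExpect_le (hO i).2.2 (star (B k))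
      change _ ≤ w k at this
      rw [h] at this
      simp [h, abs_eq_zero.1 (le_antisymm this (abs_nonneg _))]
    · rw [mul_div_cancel₀ _ h]
  calc ∑ i, (∑ k, pureExpect (O i) (star (B k))) ^ 2
      ≤ ∑ i, (∑ k, w k) * ∑ k, pureExpect (O i) (star (B k)) ^ 2 / w k :=
        Finset.sum_le_sum fun i _ => key i
    _ = (∑ k, w k) * ∑ k, (∑ i, pureExpect (O i) (star (B k)) ^ 2) / w k := by
        simp only [Finset.sum_div]
        rw [← Finset.mul_sum, Finset.sum_comm (s := (Finset.univ : Finset (Fin M)))]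
    _ ≤ (∑ k, w k) * ∑ k, M * delta O * w k := by
        refine mul_le_mul_of_nonneg_left (Finset.sum_le_sum fun k _ => ?_)
          (Finset.sum_nonneg fun k _ => hw k)
        refine div_le_of_le_mul₀ (hw k) (by have := hw k; positivity) ?_
        exact (sum_pureExpect_sq_le hM hO _).trans_eq (by simp only [w]; ring)
    _ = M * delta O * (∑ k, w k) ^ 2 := by rw [← Finset.mul_sum]; ring

end delta

/-! ### States -/

lemma mixedState_isState : IsState (mixedState n) := by
  refine ⟨Matrix.PosSemidef.one.smul (by positivity), ?_⟩
  simp [mixedState]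

lemma posSemidef_one_add_smul {O : QMatrix n} (hO : IsTracelessObservable O) {η : ℝ}
    (hη : |η| ≤ 1) : (1 + (η : ℂ) • O).PosSemidef := by
  have hH : (1 + (η : ℂ) • O).IsHermitian := by
    refine Matrix.isHermitian_one.add ?_
    rw [Matrix.IsHermitian, Matrix.conjTranspose_smul, hO.1.eq]
    simp
  refine Matrix.PosSemidef.of_dotProduct_mulVec_nonneg hH fun φ => ?_
  have him := hH.im_star_dotProduct_mulVec_self φ
  rw [Complex.nonneg_iff]
  refine ⟨?_, him.symm⟩
  have h1 : (star φ ⬝ᵥ ((1 + (η : ℂ) • O) *ᵥ φ)).re = (∑ j, ‖φ j‖ ^ 2) + η * pureExpect O φ := by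
    rw [Matrix.add_mulVec, Matrix.one_mulVec, dotProduct_add, dotProduct_star_self_eq,
      Matrix.smul_mulVec, dotProduct_smul, smul_eq_mul, Complex.add_re, Complex.ofReal_re,
      Complex.re_ofReal_mul, pureExpect]
  have h2 : |η * pureExpect O φ| ≤ ∑ j, ‖φ j‖ ^ 2 := by
    rw [abs_mul]
    exact (mul_le_of_le_one_left (abs_nonneg _) hη).trans (abs_pureExpect_le hO.2.2 φ)
  rw [h1]
  linarith [neg_abs_le (η * pureExpect O φ)]

lemma spikeState_isState {O : QMatrix n} (hO : IsTracelessObservable O) {η : ℝ}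
    (hη : |η| ≤ 1) : IsState (spikeState η O) := by
  refine ⟨(posSemidef_one_add_smul hO hη).smul (by positivity), ?_⟩
  simp [spikeState, hO.2.1]

lemma expect_spikeState {O : QMatrix n} (hO : O.trace = 0) (η : ℝ) :
    expect O (spikeState η O) = η * ((O * O).trace.re / 2 ^ n) := by
  have h : ((2 : ℂ) ^ n)⁻¹ = (((2 : ℝ) ^ n)⁻¹ : ℝ) := by push_cast; rfl
  rw [expect, spikeState, Matrix.mul_smul, Matrix.mul_add, Matrix.mul_one, Matrix.mul_smul,
    Matrix.trace_smul, Matrix.trace_add, hO, zero_add, Matrix.trace_smul, smul_eq_mul, smul_eq_mul,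
    h, Complex.re_ofReal_mul, Complex.re_ofReal_mul]
  ring

/-! ### Single measurements -/

namespace POVM

variable {k : ℕ} (F : POVM n k)

lemma sum_prob {ρ : QMatrix n} (hρ : ρ.trace = 1) : ∑ s, F.prob ρ s = 1 := by
  simp only [prob]
  rw [← Complex.re_sum, ← Matrix.trace_sum, ← Finset.sum_mul, F.sum_effect, Matrix.one_mul, hρ,
    Complex.one_re]

/-- The normalised expectation value `Tr (F_s O) / Tr F_s`. -/
noncomputable def score (O : QMatrix n) (s : Fin k) : ℝ :=
  (F.effect s * O).trace.re / (F.effect s).trace.re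

lemma prob_mixedState (s : Fin k) :
    F.prob (mixedState n) s = (2 ^ n)⁻¹ * (F.effect s).trace.re := by
  have h : ((2 : ℂ) ^ n)⁻¹ = (((2 : ℝ) ^ n)⁻¹ : ℝ) := by push_cast; rfl
  rw [prob, mixedState, Matrix.mul_smul, Matrix.mul_one, Matrix.trace_smul, smul_eq_mul, h,
    Complex.re_ofReal_mul]

lemma trace_re_nonneg (s : Fin k) : 0 ≤ (F.effect s).trace.re :=
  (Complex.nonneg_iff.1 (F.posSemidef s).trace_nonneg).1

lemma prob_mixedState_nonneg (s : Fin k) : 0 ≤ F.prob (mixedState n) s := by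
  have := F.trace_re_nonneg s
  rw [prob_mixedState]; positivity

variable {O : QMatrix n} (hO : IsTracelessObservable O)
include hO

/-- An effect of trace zero has score `0` by the division convention; the identity survives because
`|Tr (F O)| ≤ Tr F`. -/
lemma trace_mul_score (s : Fin k) :
    (F.effect s).trace.re * F.score O s = (F.effect s * O).trace.re := by
  rcases eq_or_ne (F.effect s).trace.re 0 with h | h
  · have := abs_trace_mul_le (F.posSemidef s) hO.2.2
    rw [h] at this
    rw [h, zero_mul, abs_eq_zero.1 (le_antisymm this (abs_nonneg _))]
  · rw [score]; field_simp

lemma abs_score_le_one (s : Fin k) : |F.score O s| ≤ 1 := by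
  have h := F.trace_re_nonneg s
  rw [score, abs_div, abs_of_nonneg h]
  exact div_le_one_of_le₀ (abs_trace_mul_le (F.posSemidef s) hO.2.2) h

lemma prob_spikeState (η : ℝ) (s : Fin k) :
    F.prob (spikeState η O) s = F.prob (mixedState n) s * (1 + η * F.score O s) := by
  have h : ((2 : ℂ) ^ n)⁻¹ = (((2 : ℝ) ^ n)⁻¹ : ℝ) := by push_cast; rfl
  rw [prob_mixedState, prob, spikeState, Matrix.mul_smul, Matrix.mul_add, Matrix.mul_one,
    Matrix.mul_smul, Matrix.trace_smul, Matrix.trace_add, Matrix.trace_smul, smul_eq_mul,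
    smul_eq_mul, h, Complex.re_ofReal_mul, Complex.add_re, Complex.re_ofReal_mul,
    ← F.trace_mul_score hO]
  ring

lemma sum_prob_mul_score : ∑ s, F.prob (mixedState n) s * F.score O s = 0 := by
  simp only [prob_mixedState, mul_assoc, F.trace_mul_score hO]
  rw [← Finset.mul_sum, ← Complex.re_sum, ← Matrix.trace_sum, ← Finset.sum_mul, F.sum_effect,
    Matrix.one_mul, hO.2.1, Complex.zero_re, mul_zero]

omit hO in
lemma sum_score_sq_le {M : ℕ} (hM : 0 < M) {O : Fin M → QMatrix n}
    (hO : ∀ i, IsTracelessObservable (O i)) (s : Fin k) :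
    ∑ i, F.score (O i) s ^ 2 ≤ M * delta O := by
  have hδ := delta_nonneg O
  simp only [score, div_pow]
  rw [← Finset.sum_div]
  exact div_le_of_le_mul₀ (sq_nonneg _) (by positivity) (sum_trace_mul_sq_le hM hO (F.posSemidef s))

end POVM

end

/-! ### Learning trees -/

namespace LearningTree

variable {n T : ℕ}

lemma sum_leaf_node {k : ℕ} (F : POVM n k) (child : Fin k → LearningTree n T)
    (f : (node F child).Leaf → ℝ) :
    ∑ l, f l = ∑ s, ∑ l : (child s).Leaf, f ⟨s, l⟩ :=
  Fintype.sum_sigma (M := ℝ) (ι := Fin k) (α := fun s => (child s).Leaf) f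

lemma sum_leaf_leaf (f : (leaf : LearningTree n 0).Leaf → ℝ) : ∑ l, f l = f () :=
  Fintype.sum_unique (ι := Unit) f

/-- The sum of the scores along the path to a leaf. -/
noncomputable def score (O : QMatrix n) : {T : ℕ} → (A : LearningTree n T) → A.Leaf → ℝ
  | _, leaf, _ => 0
  | _, node F child, l => F.score O l.1 + (child l.1).score O l.2

/-- The sum of the squared scores along the path to a leaf. -/
noncomputable def quadVar (O : QMatrix n) : {T : ℕ} → (A : LearningTree n T) → A.Leaf → ℝ
  | _, leaf, _ => 0
  | _, node F child, l => F.score O l.1 ^ 2 + (child l.1).quadVar O l.2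

/-- The likelihood ratio of the states `(I + η O) / 2 ^ n` and `I / 2 ^ n` at a leaf. -/
noncomputable def likelihood (η : ℝ) (O : QMatrix n) :
    {T : ℕ} → (A : LearningTree n T) → A.Leaf → ℝ
  | _, leaf, _ => 1
  | _, node F child, l => (1 + η * F.score O l.1) * (child l.1).likelihood η O l.2

/-- The mean of a function of the leaf for the maximally mixed state. -/
noncomputable def mean (A : LearningTree n T) (f : A.Leaf → ℝ) : ℝ :=
  ∑ l, A.leafProb (mixedState n) l * f l

lemma mean_node {k : ℕ} (F : POVM n k) (child : Fin k → LearningTree n T)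
    (f : (node F child).Leaf → ℝ) :
    (node F child).mean f =
      ∑ s, F.prob (mixedState n) s * (child s).mean fun l => f ⟨s, l⟩ := by
  rw [mean, sum_leaf_node]
  simp only [mean, Finset.mul_sum, leafProb, mul_assoc]

lemma mean_leaf (f : (leaf : LearningTree n 0).Leaf → ℝ) :
    (leaf : LearningTree n 0).mean f = f () :=
  (sum_leaf_leaf _).trans (one_mul _)

lemma mean_add (A : LearningTree n T) (f g : A.Leaf → ℝ) :
    A.mean (fun l => f l + g l) = A.mean f + A.mean g := by
  simp only [mean, mul_add, Finset.sum_add_distrib]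

lemma mean_const_mul (A : LearningTree n T) (c : ℝ) (f : A.Leaf → ℝ) :
    A.mean (fun l => c * f l) = c * A.mean f := by
  simp only [mean, Finset.mul_sum, mul_left_comm]

lemma sum_leafProb {ρ : QMatrix n} (hρ : ρ.trace = 1) (A : LearningTree n T) :
    ∑ l, A.leafProb ρ l = 1 := by
  induction A with
  | leaf => exact sum_leaf_leaf _
  | node F child ih =>
    rw [sum_leaf_node]
    simp only [leafProb, ← Finset.mul_sum, ih, mul_one, F.sum_prob hρ]

lemma mean_const (A : LearningTree n T) (c : ℝ) : A.mean (fun _ => c) = c := by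
  rw [mean, ← Finset.sum_mul, A.sum_leafProb mixedState_isState.2, one_mul]

lemma leafProb_mixedState_nonneg (A : LearningTree n T) (l : A.Leaf) :
    0 ≤ A.leafProb (mixedState n) l := by
  induction A with
  | leaf => exact zero_le_one
  | node F child ih => exact mul_nonneg (F.prob_mixedState_nonneg _) (ih _ _)

lemma mean_mono (A : LearningTree n T) {f g : A.Leaf → ℝ} (h : ∀ l, f l ≤ g l) :
    A.mean f ≤ A.mean g :=
  Finset.sum_le_sum fun l _ => mul_le_mul_of_nonneg_left (h l) (A.leafProb_mixedState_nonneg l)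

lemma quadVar_nonneg (O : QMatrix n) (A : LearningTree n T) (l : A.Leaf) :
    0 ≤ A.quadVar O l := by
  induction A with
  | leaf => exact le_rfl
  | node F child ih => exact add_nonneg (sq_nonneg _) (ih _ _)

/-! ### Martingale and likelihood estimates for one observable -/

section

variable {O : QMatrix n} (hO : IsTracelessObservable O)
include hO

lemma leafProb_spikeState (η : ℝ) (A : LearningTree n T) (l : A.Leaf) :
    A.leafProb (spikeState η O) l = A.leafProb (mixedState n) l * A.likelihood η O l := by
  induction A with
  | leaf => simp only [leafProb, likelihood, mul_one]
  | node F child ih =>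
    simp only [leafProb, likelihood, ih, F.prob_spikeState hO]
    ring

lemma mean_score (A : LearningTree n T) : A.mean (A.score O) = 0 := by
  induction A with
  | leaf => exact mean_leaf _
  | node F child ih =>
    rw [mean_node]
    simp only [score, mean_add, mean_const]
    simpa [ih] using F.sum_prob_mul_score hO

/-- Cross terms vanish: given the first outcome, the later scores have mean zero. -/
lemma mean_score_sq (A : LearningTree n T) :
    A.mean (fun l => A.score O l ^ 2) = A.mean (A.quadVar O) := by
  induction A with
  | leaf => simp only [mean_leaf, score, quadVar]; norm_num
  | node F child ih =>
    rw [mean_node, mean_node]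
    refine Finset.sum_congr rfl fun s _ => ?_
    simp only [score, quadVar, mean_add, mean_const, add_sq, ih, mul_assoc, mean_const_mul,
      mean_score hO]
    ring

lemma likelihood_nonneg {η : ℝ} (hη : |η| ≤ 1) (A : LearningTree n T) (l : A.Leaf) :
    0 ≤ A.likelihood η O l := by
  induction A with
  | leaf => exact zero_le_one
  | node F child ih =>
    refine mul_nonneg ?_ (ih _ _)
    have : |η * F.score O l.1| ≤ 1 := by
      rw [abs_mul]
      exact mul_le_one₀ hη (abs_nonneg _) (F.abs_score_le_one hO _)
    linarith [neg_abs_le (η * F.score O l.1)]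

omit hO in
lemma _root_.ShadowLower.exp_sub_sq_le {x : ℝ} (hx : -(1 / 2) ≤ x) :
    Real.exp (x - x ^ 2) ≤ 1 + x := by
  have hfac : 1 ≤ (1 + x) * Real.exp (x ^ 2 - x) := by
    rcases le_or_gt 0 x with h | h
    · nlinarith [Real.add_one_le_exp (x ^ 2 - x), pow_nonneg h 3]
    · have hq := Real.quadratic_le_exp_of_nonneg (show 0 ≤ x ^ 2 - x by nlinarith)
      have hpoly : 0 ≤ 1 + x - x ^ 2 + x ^ 3 := by nlinarith [sq_nonneg x]
      -- The product exceeds `1` by exactly `x ^ 2 / 2` times the polynomial in `hpoly`.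
      refine le_trans ?_ (mul_le_mul_of_nonneg_left hq (show 0 ≤ 1 + x by linarith))
      linarith [mul_nonneg (sq_nonneg x) hpoly]
  calc Real.exp (x - x ^ 2)
      ≤ Real.exp (x - x ^ 2) * ((1 + x) * Real.exp (x ^ 2 - x)) :=
        le_mul_of_one_le_right (Real.exp_nonneg _) hfac
    _ = (1 + x) * Real.exp ((x - x ^ 2) + (x ^ 2 - x)) := by rw [Real.exp_add]; ring
    _ = 1 + x := by simp

omit hO in
-- A single factor with `η x < -1/2` already forces `4 η ^ 2 V ≥ 1`; otherwise `exp_sub_sq_le`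
-- applies to every factor.
lemma one_le_or_exp_le_likelihood (η : ℝ) (A : LearningTree n T) (l : A.Leaf) :
    1 ≤ 4 * η ^ 2 * A.quadVar O l ∨
      Real.exp (η * A.score O l - η ^ 2 * A.quadVar O l) ≤ A.likelihood η O l := by
  induction A with
  | leaf => right; simp only [score, quadVar, likelihood]; norm_num
  | node F child ih =>
    set x := F.score O l.1 with hx
    have hV := (child l.1).quadVar_nonneg O l.2
    have hηV := mul_nonneg (sq_nonneg η) hV
    have hηx := sq_nonneg (η * x)
    have hsplit : (node F child).quadVar O l = x ^ 2 + (child l.1).quadVar O l.2 := rfl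
    rcases ih l.1 l.2 with h | h
    · left; rw [hsplit]; nlinarith
    · rcases lt_or_ge (η * x) (-(1 / 2)) with h' | h'
      · left; rw [hsplit]; nlinarith
      · right
        have hexp := exp_sub_sq_le h'
        simp only [score, likelihood, hsplit, ← hx]
        calc _ = Real.exp (η * x - (η * x) ^ 2) * Real.exp
              (η * (child l.1).score O l.2 - η ^ 2 * (child l.1).quadVar O l.2) := by
              rw [← Real.exp_add]; ring_nf
          _ ≤ _ := mul_le_mul hexp h (Real.exp_nonneg _) ((Real.exp_nonneg _).trans hexp)

lemma one_sub_likelihood_le {η : ℝ} (hη : |η| ≤ 1) (A : LearningTree n T) (l : A.Leaf) :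
    1 - A.likelihood η O l ≤ |η * A.score O l| + 4 * η ^ 2 * A.quadVar O l := by
  have hV := mul_nonneg (sq_nonneg η) (A.quadVar_nonneg O l)
  rcases A.one_le_or_exp_le_likelihood (O := O) η l with h | h
  · linarith [A.likelihood_nonneg hO hη l, abs_nonneg (η * A.score O l)]
  · linarith [Real.add_one_le_exp (η * A.score O l - η ^ 2 * A.quadVar O l),
      neg_abs_le (η * A.score O l)]

/-- Integrates the bound on `1 - L`. The free parameter `a` comes from `|η S| ≤ a / 2 + (η S) ^ 2 /
(2 a)`, which brings in the second moment of `S`. -/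
lemma prob_mixedState_le {η : ℝ} (hη : |η| ≤ 1) {a : ℝ} (ha : 0 < a)
    (A : LearningTree n T) (E : Set A.Leaf) :
    A.prob (mixedState n) E ≤
      A.prob (spikeState η O) E + (a / 2 + (1 / (2 * a) + 4) * (η ^ 2 * A.mean (A.quadVar O))) := by
  classical
  set g : A.Leaf → ℝ := fun l => a / 2 + (η ^ 2 / (2 * a) * A.score O l ^ 2 +
    4 * η ^ 2 * A.quadVar O l)
  have hg (l) : |η * A.score O l| + 4 * η ^ 2 * A.quadVar O l ≤ g l := by
    have : |η * A.score O l| ≤ a / 2 + η ^ 2 / (2 * a) * A.score O l ^ 2 := by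
      have h := sq_nonneg (|η * A.score O l| - a)
      have h2 := sq_abs (η * A.score O l)
      have : a / 2 + η ^ 2 / (2 * a) * A.score O l ^ 2 =
          (a ^ 2 + (η * A.score O l) ^ 2) / (2 * a) := by field_simp
      rw [this, le_div_iff₀ (by positivity)]
      nlinarith
    simp only [g]; linarith
  have hmean : A.mean g =
      a / 2 + (1 / (2 * a) + 4) * (η ^ 2 * A.mean (A.quadVar O)) := by
    simp only [g, mean_add, mean_const, mean_const_mul, mean_score_sq hO]
    ring
  rw [← hmean, prob, prob, mean, ← Finset.sum_add_distrib]
  refine Finset.sum_le_sum fun l _ => ?_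
  have hP := A.leafProb_mixedState_nonneg l
  have hV := mul_nonneg (sq_nonneg η) (A.quadVar_nonneg O l)
  have hgl := hg l
  have hL := A.one_sub_likelihood_le hO hη l
  split_ifs
  · rw [leafProb_spikeState hO]; nlinarith
  · have : 0 ≤ g l := by linarith [abs_nonneg (η * A.score O l)]
    positivity

end

lemma prob_compl {ρ : QMatrix n} (hρ : ρ.trace = 1) (A : LearningTree n T) (E : Set A.Leaf) :
    A.prob ρ Eᶜ = 1 - A.prob ρ E := by
  classical
  rw [eq_sub_iff_add_eq, ← A.sum_leafProb hρ, prob, prob, ← Finset.sum_add_distrib]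
  refine Finset.sum_congr rfl fun l _ => ?_
  by_cases h : l ∈ E <;> simp [h]

lemma prob_mixedState_mono (A : LearningTree n T) {E E' : Set A.Leaf} (h : E ⊆ E') :
    A.prob (mixedState n) E ≤ A.prob (mixedState n) E' := by
  classical
  refine Finset.sum_le_sum fun l _ => ?_
  have := A.leafProb_mixedState_nonneg l
  by_cases h1 : l ∈ E
  · simp [h1, h h1]
  · by_cases h2 : l ∈ E' <;> simp [h1, h2, this]

lemma prob_spikeState_le {O : QMatrix n} (hO : IsTracelessObservable O) {η : ℝ} (hη : |η| ≤ 1)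
    {a : ℝ} (ha : 0 < a) (A : LearningTree n T) (E : Set A.Leaf) :
    A.prob (spikeState η O) E ≤
      A.prob (mixedState n) E + (a / 2 + (1 / (2 * a) + 4) * (η ^ 2 * A.mean (A.quadVar O))) := by
  have h := A.prob_mixedState_le hO hη ha Eᶜ
  rw [A.prob_compl mixedState_isState.2, A.prob_compl (spikeState_isState hO hη).2] at h
  linarith

lemma prob_add_prob_le {O : QMatrix n} (hO : IsTracelessObservable O) {η : ℝ} (hη : |η| ≤ 1)
    {a : ℝ} (ha : 0 < a) (A : LearningTree n T) {E E' : Set A.Leaf} (h : Disjoint E E') :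
    A.prob (spikeState η O) E + A.prob (spikeState (-η) O) E' ≤
      1 + (a + 2 * (1 / (2 * a) + 4) * (η ^ 2 * A.mean (A.quadVar O))) := by
  have h1 := A.prob_spikeState_le hO hη ha E
  have h2 := A.prob_spikeState_le hO ((abs_neg η).trans_le hη) ha E'
  have h3 := A.prob_mixedState_mono h.subset_compl_left
  rw [A.prob_compl mixedState_isState.2] at h3
  rw [neg_sq] at h2
  linarith

/-! ### Summing over the observables -/

lemma sum_quadVar_le {M : ℕ} (hM : 0 < M) {O : Fin M → QMatrix n}
    (hO : ∀ i, IsTracelessObservable (O i)) (A : LearningTree n T) (l : A.Leaf) :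
    ∑ i, A.quadVar (O i) l ≤ T * (M * delta O) := by
  induction A with
  | leaf => simp [quadVar]
  | node F child ih =>
    simp only [quadVar, Finset.sum_add_distrib]
    push_cast
    linarith [ih l.1 l.2, F.sum_score_sq_le hM hO l.1]

lemma sum_mean_quadVar_le {M : ℕ} (hM : 0 < M) {O : Fin M → QMatrix n}
    (hO : ∀ i, IsTracelessObservable (O i)) (A : LearningTree n T) :
    ∑ i, A.mean (A.quadVar (O i)) ≤ T * (M * delta O) := by
  calc ∑ i, A.mean (A.quadVar (O i)) = A.mean fun l => ∑ i, A.quadVar (O i) l := by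
        simp only [mean, Finset.mul_sum]
        exact Finset.sum_comm
    _ ≤ A.mean fun _ => T * (M * delta O) := A.mean_mono fun l => A.sum_quadVar_le hM hO l
    _ = _ := A.mean_const _

end LearningTree

/-! ### The lower bounds -/

section

variable {n M T : ℕ} {O : Fin M → QMatrix n}

lemma le_of_le_distinguishProb (hM : 0 < M) (hO : ∀ i, IsTracelessObservable (O i))
    {p a ε : ℝ} (ha : 0 < a) (hε0 : 0 < ε) (hε : ε ≤ 1) (A : LearningTree n T)
    (guess : Set A.Leaf) (h : p ≤ distinguishProb O ε A guess) :
    2 * p - 1 ≤ a / 2 + (1 / (2 * a) + 4) * (ε ^ 2 * (T * delta O)) := by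
  have hM' : (0 : ℝ) < M := by exact_mod_cast hM
  have hε' : |ε| ≤ 1 := by rwa [abs_of_pos hε0]
  have hsum : ∑ i, A.prob (spikeState ε (O i)) guess ≤ ∑ i, ((1 - A.prob (mixedState n) guessᶜ) +
      a / 2 + (1 / (2 * a) + 4) * ε ^ 2 * A.mean (A.quadVar (O i))) := by
    refine Finset.sum_le_sum fun i _ => ?_
    have := A.prob_spikeState_le (hO i) hε' ha guess
    rw [A.prob_compl mixedState_isState.2]
    linarith
  rw [Finset.sum_add_distrib, Finset.sum_const, ← Finset.mul_sum, Finset.card_univ,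
    Fintype.card_fin, nsmul_eq_mul] at hsum
  have hq := mul_le_mul_of_nonneg_left (A.sum_mean_quadVar_le hM hO)
    (show 0 ≤ (1 / (2 * a) + 4) * ε ^ 2 by positivity)
  have h1 : (1 / (M : ℝ)) * ∑ i, A.prob (spikeState ε (O i)) guess ≤
      (1 - A.prob (mixedState n) guessᶜ) + a / 2 +
        (1 / (2 * a) + 4) * (ε ^ 2 * (T * delta O)) := by
    rw [one_div_mul_eq_div, div_le_iff₀ hM']
    linarith
  rw [distinguishProb] at h
  linarith

lemma le_of_separated (hM : 0 < M) (hO : ∀ i, IsTracelessObservable (O i))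
    {p a η : ℝ} (ha : 0 < a) (hη : |η| ≤ 1) (A : LearningTree n T)
    (E E' : Fin M → Set A.Leaf) (hE : ∀ i, Disjoint (E i) (E' i))
    (h : ∀ i, p ≤ A.prob (spikeState η (O i)) (E i))
    (h' : ∀ i, p ≤ A.prob (spikeState (-η) (O i)) (E' i)) :
    2 * p - 1 ≤ a + 2 * (1 / (2 * a) + 4) * (η ^ 2 * (T * delta O)) := by
  have hM' : (0 : ℝ) < M := by exact_mod_cast hM
  have hsum : ∑ _i : Fin M, (2 * p - 1) ≤
      ∑ i, (a + 2 * (1 / (2 * a) + 4) * η ^ 2 * A.mean (A.quadVar (O i))) := by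
    refine Finset.sum_le_sum fun i _ => ?_
    have := A.prob_add_prob_le (hO i) hη ha (hE i)
    linarith [h i, h' i]
  rw [Finset.sum_add_distrib, Finset.sum_const, Finset.sum_const, ← Finset.mul_sum,
    Finset.card_univ, Fintype.card_fin, nsmul_eq_mul, nsmul_eq_mul] at hsum
  have hq := mul_le_mul_of_nonneg_left (A.sum_mean_quadVar_le hM hO)
    (show 0 ≤ 2 * (1 / (2 * a) + 4) * η ^ 2 by positivity)
  refine le_of_mul_le_mul_left ?_ hM'
  linarith

end

end ShadowLower

theorem theoremA2 (p : ℝ) (hp : 1 / 2 < p) :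
    ∃ c : ℝ, 0 < c ∧ ∀ (n M : ℕ), 0 < M → ∀ O : Fin M → QMatrix n,
      (∀ i, IsTracelessObservable (O i)) →
      -- distinguishing `I / 2 ^ n` from a random `(I + ε O_i) / 2 ^ n`
      (∀ ε : ℝ, 0 < ε → ε ≤ 1 → ∀ (T : ℕ) (A : LearningTree n T) (guess : Set A.Leaf),
        p ≤ distinguishProb O ε A guess →
        0 < delta O ∧ c / (ε ^ 2 * delta O) ≤ T) ∧
      -- predicting all `Tr (O_i ρ)`, for observables with `Tr (O_i ^ 2) ≥ κ 2 ^ n`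
      (∀ κ : ℝ, (∀ i, κ * 2 ^ n ≤ (O i * O i).trace.re) →
        ∀ ε : ℝ, 0 < ε → ∀ (T : ℕ) (A : LearningTree n T) (out : A.Leaf → Fin M → ℝ),
        (ε < κ ∧
            (∀ ρ : QMatrix n, IsState ρ →
              p ≤ A.prob ρ {l | ∀ i, |out l i - expect (O i) ρ| ≤ ε})) ∨
          (ε ≤ κ ∧
            (∀ ρ : QMatrix n, IsState ρ →
              p ≤ A.prob ρ {l | ∀ i, |out l i - expect (O i) ρ| < ε})) →
        0 < delta O ∧ c * κ ^ 2 / (ε ^ 2 * delta O) ≤ T) := by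
  set g : ℝ := 2 * p - 1 with hg
  have hg0 : 0 < g := by linarith
  set K : ℝ := 1 / g + 4 with hK
  have hK0 : 0 < K := by positivity
  have hKeq : 1 / (2 * (g / 2)) + 4 = K := by rw [hK]; ring_nf
  -- Prediction dictates the constant: with `a = g / 2` it gives `g / 2 ≤ 2 K η ^ 2 T δ`, and `η ^ 2
  -- ≤ 4 ε ^ 2 / κ ^ 2`.
  refine ⟨g / (16 * K), by positivity, fun n M hM O hO => ⟨?_, ?_⟩⟩
  · intro ε hε0 hε T A guess h
    have hδ := delta_nonneg O
    have h1 := le_of_le_distinguishProb hM hO (half_pos hg0) hε0 hε A guess h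
    rw [hKeq, ← hg] at h1
    have h2 : 3 * g / 4 ≤ K * (ε ^ 2 * (T * delta O)) := by linarith
    have hδ0 : 0 < delta O := by
      refine hδ.lt_of_ne fun h0 => ?_
      rw [← h0] at h2
      linarith
    refine ⟨hδ0, ?_⟩
    rw [div_le_iff₀ (by positivity), div_le_iff₀ (by positivity)]
    linarith
  · intro κ hκ ε hε0 T A out h
    have hδ := delta_nonneg O
    have hεκ : ε ≤ κ := by rcases h with h | h; exacts [h.1.le, h.1]
    have hκ0 : 0 < κ := hε0.trans_le hεκ
    -- The cap at `1` keeps the matrices states. The two expectations of `O i` differ by at least `2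
    -- η κ`, which is `4 ε` or `2 κ`: enough to separate the estimates up to `ε = κ`, where strict
    -- errors are needed.
    set η : ℝ := min 1 (2 * ε / κ) with hη
    have hη0 : 0 < η := by positivity
    have hη1 : |η| ≤ 1 := by rw [abs_of_pos hη0]; exact min_le_left _ _
    have hη2 : η * κ ≤ 2 * ε := by
      rw [← le_div_iff₀ hκ0]; exact min_le_right _ _
    have hηκ : η * κ = κ ∨ η * κ = 2 * ε := by
      rcases min_choice 1 (2 * ε / κ) with h | h
      · left; rw [hη, h, one_mul]
      · right; rw [hη, h]; field_simp
    have hκ' (i) : η * κ ≤ η * ((O i * O i).trace.re / 2 ^ n) := by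
      gcongr
      rw [le_div_iff₀ (by positivity)]
      exact hκ i
    have hst (i) := spikeState_isState (hO i) hη1
    have hst' (i) := spikeState_isState (hO i) ((abs_neg η).trans_le hη1)
    have h1 : g ≤ g / 2 + 2 * K * (η ^ 2 * (T * delta O)) := by
      rw [← hKeq]
      rcases h with ⟨hlt, h⟩ | ⟨-, h⟩
      · refine le_of_separated hM hO (half_pos hg0) hη1 A _ _ (fun i => ?_)
          (fun i => h _ (hst i)) (fun i => h _ (hst' i))
        refine Set.disjoint_left.2 fun l hl hl' => ?_
        have h1 := abs_le.1 (hl i)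
        have h2 := abs_le.1 (hl' i)
        rw [expect_spikeState (hO i).2.1] at h1 h2
        rcases hηκ with h3 | h3 <;> linarith [hκ' i, h1.1, h2.2]
      · refine le_of_separated hM hO (half_pos hg0) hη1 A _ _ (fun i => ?_)
          (fun i => h _ (hst i)) (fun i => h _ (hst' i))
        refine Set.disjoint_left.2 fun l hl hl' => ?_
        have h1 := abs_lt.1 (hl i)
        have h2 := abs_lt.1 (hl' i)
        rw [expect_spikeState (hO i).2.1] at h1 h2
        rcases hηκ with h3 | h3 <;> linarith [hκ' i, h1.1, h2.2]
    have hsq : η ^ 2 * κ ^ 2 ≤ 4 * ε ^ 2 := by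
      have := mul_self_le_mul_self (by positivity) hη2
      linarith
    have h2 : g / 2 ≤ 2 * K * (η ^ 2 * (T * delta O)) := by linarith
    have hδ0 : 0 < delta O := by
      refine hδ.lt_of_ne fun h0 => ?_
      rw [← h0] at h2
      linarith
    refine ⟨hδ0, ?_⟩
    rw [div_le_iff₀ (by positivity), div_mul_eq_mul_div, div_le_iff₀ (by positivity)]
    have h3 := mul_le_mul_of_nonneg_right h2 (sq_nonneg κ)
    have h4 := mul_le_mul_of_nonneg_left hsq (show 0 ≤ 2 * K * (T * delta O) by positivity)
    linarith
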